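/- For positive integers $r,s,t$ put $n=r+s+t+1$. The exchanged 3-ary $n$-cube $E3C(r,s,t)$ is the simple graph whose vertices are the strings $ABCd$ with $A\in\{0,1,2\}^r$, $B\in\{0,1,2\}^s$, $C\in\{0,1,2\}^t$, $d\in\{0,1,2\}$, in which two vertices $ABCd$ and $A'B'C'd'$ are adjacent if and only if one of the following holds (where $H$ denotes the Hamming distance): (0) $A=A'$, $B=B'$, $C=C'$ and $d\neq d'$; (1) $d=d'=0$, $A=A'$, $B=B'$ and $H(C,C')=1$; (2) $d=d'=1$, $A=A'$, $C=C'$ and $H(B,B')=1$; (3) $d=d'=2$, $B=B'$, $C=C'$ and $H(A,A')=1$. For a finite graph $G$ and a positive integer $\alpha$, the $\alpha$-fault diameter $D^f_\alpha(G)$ is the maximum of $d_{G-F}(u,v)$ over all pairs of distinct vertices $u,v$ of $G$ and all sets $F\subseteq V(G)\setminus\{u,v\}$ with $|F|=\alpha$ (it is $\infty$ if some such $G-F$ contains no path from $u$ to $v$). For a positive integer $\beta$, the $\beta$-wide diameter $D_\beta(G)$ is the maximum, over all pairs of distinct vertices $u,v$, of the least integer $\ell$ for which there are $\beta$ distinct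 paths from $u$ to $v$, each of length at most $\ell$, any two of which have no common vertices other than $u$ and $v$ (it is $\infty$ if for some $u,v$ there is no such $\ell$). Theorem. For all integers $1\le r\le s\le t$ and $n=r+s+t+1$, $$n+3\;\le\; D^f_{2r+1}(E3C(r,s,t))\;\le\; D_{2r+2}(E3C(r,s,t))\;\le\; n+5 .$$ -/

import Mathlib

/-- The vertices of the exchanged 3-ary cube with parameters `r`, `s`, `t`: a ternary string
`a_{r-1} ⋯ a_0 b_{s-1} ⋯ b_0 c_{t-1} ⋯ c_0 d`, stored as its blocks `(A, B, C, d)`. -/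
abbrev E3CVertex (r s t : ℕ) : Type :=
  (Fin r → Fin 3) × (Fin s → Fin 3) × (Fin t → Fin 3) × Fin 3

/-- The adjacency relation of the exchanged 3-ary cube. The four alternatives are the edge types
`E₀`, `E₁`, `E₂`, `E₃`. -/
def E3CAdj {r s t : ℕ} : E3CVertex r s t → E3CVertex r s t → Prop
  | (A, B, C, d), (A', B', C', d') =>
    (A = A' ∧ B = B' ∧ C = C' ∧ d ≠ d') ∨
    (A = A' ∧ B = B' ∧ hammingDist C C' = 1 ∧ d = 0 ∧ d' = 0) ∨
    (A = A' ∧ hammingDist B B' = 1 ∧ C = C' ∧ d = 1 ∧ d' = 1) ∨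
    (hammingDist A A' = 1 ∧ B = B' ∧ C = C' ∧ d = 2 ∧ d' = 2)

/-- The exchanged 3-ary `n`-cube `E3C(r,s,t)`, where `n = r + s + t + 1`. -/
def E3C (r s t : ℕ) : SimpleGraph (E3CVertex r s t) where
  Adj := E3CAdj
  symm := ⟨by
    rintro ⟨A, B, C, d⟩ ⟨A', B', C', d'⟩ h
    rcases h with ⟨h₁, h₂, h₃, h₄⟩ | ⟨h₁, h₂, h₃, h₄, h₅⟩ | ⟨h₁, h₂, h₃, h₄, h₅⟩ |
      ⟨h₁, h₂, h₃, h₄, h₅⟩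
    · exact Or.inl ⟨h₁.symm, h₂.symm, h₃.symm, h₄.symm⟩
    · exact Or.inr (Or.inl ⟨h₁.symm, h₂.symm, by rw [hammingDist_comm]; exact h₃, h₅, h₄⟩)
    · exact Or.inr (Or.inr (Or.inl
        ⟨h₁.symm, by rw [hammingDist_comm]; exact h₂, h₃.symm, h₅, h₄⟩))
    · exact Or.inr (Or.inr (Or.inr
        ⟨by rw [hammingDist_comm]; exact h₁, h₂.symm, h₃.symm, h₅, h₄⟩))⟩
  loopless := ⟨by
    rintro ⟨A, B, C, d⟩ h
    simp [E3CAdj] at h⟩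

/-- The `α`-fault distance of `u` and `v`: the largest distance of `u` and `v` in `G - F`, over all
sets `F` of `α` vertices that contain neither `u` nor `v`. It is `⊤` if some such `F`
separates `u` from `v`. -/
noncomputable def faultDist {V : Type*} (G : SimpleGraph V) (α : ℕ) (u v : V) : ℕ∞ :=
  ⨆ (F : Finset V) (_ : F.card = α) (hu : u ∉ F) (hv : v ∉ F),
    (G.induce {x : V | x ∉ F}).edist ⟨u, hu⟩ ⟨v, hv⟩

/-- The `α`-fault diameter of `G`: the largest `α`-fault distance of two distinct vertices. -/
noncomputable def faultDiam {V : Type*} (G : SimpleGraph V) (α : ℕ) : ℕ∞ :=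
  ⨆ (u : V) (v : V) (_ : u ≠ v), faultDist G α u v

/-- `P` is a family of `β` different paths from `u` to `v`, any two of which have
no common vertices other than `u` and `v`. -/
def IsInternallyDisjoint {V : Type*} {G : SimpleGraph V} {u v : V} {β : ℕ}
    (P : Fin β → G.Path u v) : Prop :=
  Function.Injective P ∧
    ∀ i j : Fin β, i ≠ j → ∀ x : V,
      x ∈ (P i).1.support → x ∈ (P j).1.support → x = u ∨ x = v

/-- The smallest possible maximal length in a family of `β` internally disjoint paths from `u`
to `v`. It is `⊤` if there is no such family. -/
noncomputable def wideDist {V : Type*} (G : SimpleGraph V) (β : ℕ) (u v : V) : ℕ∞ :=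
  ⨅ (P : Fin β → G.Path u v) (_ : IsInternallyDisjoint P),
    ⨆ i : Fin β, ((P i).1.length : ℕ∞)

/-- The `β`-wide diameter of `G`. -/
noncomputable def wideDiam {V : Type*} (G : SimpleGraph V) (β : ℕ) : ℕ∞ :=
  ⨆ (u : V) (v : V) (_ : u ≠ v), wideDist G β u v

/-! For fixed other coordinates, layer `d = 2`, `1` or `0` is a ternary Hamming cube in the block
`A`, `B` or `C`, and a block can change only in its own layer.

Lower bound: a vertex of layer 2 has `2r + 2` neighbours. Deleting all but one forces the first
step. If the target lies in layer 2 and differs from the surviving neighbour in every entry of all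
blocks, then `r + s + t` entry changes and a tour `2, 1, 0, 2` (or its reverse) remain. This gives
`1 + (r + s + t) + 3 = n + 3` (`le_faultDiam_E3C`).

Middle inequality: `β` faults cannot meet all of `β + 1` internally disjoint paths
(`faultDiam_le_wideDiam`).

Upper bound: block permutations reduce to a source in layer 2 and a target in layer 2 or 1. Most
paths first move to distinct vertices near the source and keep that difference as a tag while they
travel through the other cubes. The remaining paths use another order of layers or a block value
`z₁` reserved for them. Each path crosses each cube at most once in full and makes at most six
further moves, hence `r + s + t + 6 = n + 5` (`wideDiam_E3C_le`). Inside one cube the disjoint paths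
come from rewriting entries in cyclic order (`cyclicMix_eq`, `exists_ternaryCube_fan`). -/

/-! ### Bounded walks confined to a set of vertices. -/

section ReachIn

variable {V W : Type*} {G : SimpleGraph V} {H : SimpleGraph W}

/-- `b` can be reached from `a` by a walk of length at most `L` that stays in `S`. -/
def ReachIn (G : SimpleGraph V) (S : Set V) (L : ℕ) (a b : V) : Prop :=
  ∃ w : G.Walk a b, w.length ≤ L ∧ ∀ x ∈ w.support, x ∈ S

theorem ReachIn.refl {S : Set V} {a : V} (ha : a ∈ S) (L : ℕ) : ReachIn G S L a a :=
  ⟨SimpleGraph.Walk.nil, by simp, by simpa using ha⟩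

theorem ReachIn.trans {S : Set V} {a b c : V} {L M : ℕ} (h : ReachIn G S L a b)
    (h' : ReachIn G S M b c) : ReachIn G S (L + M) a c := by
  obtain ⟨w, hw, hS⟩ := h
  obtain ⟨w', hw', hS'⟩ := h'
  refine ⟨w.append w', by rw [SimpleGraph.Walk.length_append]; omega, fun x hx => ?_⟩
  rw [SimpleGraph.Walk.mem_support_append_iff] at hx
  exact hx.elim (hS x) (hS' x)

theorem ReachIn.mono {S T : Set V} {a b : V} {L M : ℕ} (h : ReachIn G S L a b) (hST : S ⊆ T)
    (hLM : L ≤ M) : ReachIn G T M a b := by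
  obtain ⟨w, hw, hS⟩ := h
  exact ⟨w, hw.trans hLM, fun x hx => hST (hS x hx)⟩

theorem ReachIn.of_adj {S : Set V} {a b : V} (h : G.Adj a b) (ha : a ∈ S) (hb : b ∈ S) :
    ReachIn G S 1 a b :=
  ⟨h.toWalk, by simp, by simp [ha, hb]⟩

theorem ReachIn.of_eq_or_adj {S : Set V} {a b : V} (h : a = b ∨ G.Adj a b) (ha : a ∈ S)
    (hb : b ∈ S) : ReachIn G S 1 a b := by
  rcases h with rfl | h
  · exact .refl ha 1
  · exact .of_adj h ha hb

theorem ReachIn.left_mem {S : Set V} {a b : V} {L : ℕ} (h : ReachIn G S L a b) : a ∈ S := by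
  obtain ⟨w, -, hS⟩ := h
  exact hS a w.start_mem_support

theorem ReachIn.right_mem {S : Set V} {a b : V} {L : ℕ} (h : ReachIn G S L a b) : b ∈ S := by
  obtain ⟨w, -, hS⟩ := h
  exact hS b w.end_mem_support

theorem ReachIn.symm {S : Set V} {a b : V} {L : ℕ} (h : ReachIn G S L a b) :
    ReachIn G S L b a := by
  obtain ⟨w, hw, hS⟩ := h
  exact ⟨w.reverse, by simpa using hw, by simpa using hS⟩

theorem ReachIn.map (f : G →g H) {S : Set V} {T : Set W} {a b : V} {L : ℕ}
    (h : ReachIn G S L a b) (hST : ∀ x ∈ S, f x ∈ T) : ReachIn H T L (f a) (f b) := by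
  obtain ⟨w, hw, hS⟩ := h
  refine ⟨w.map f, by simpa using hw, fun x hx => ?_⟩
  rw [SimpleGraph.Walk.support_map, List.mem_map] at hx
  obtain ⟨y, hy, rfl⟩ := hx
  exact hST y (hS y hy)

/-- Pauses are allowed because rewriting an entry that is already correct moves nowhere. -/
theorem ReachIn.of_seq (f : ℕ → V) (n : ℕ) (h : ∀ i < n, f i = f (i + 1) ∨ G.Adj (f i) (f (i + 1)))
    {S : Set V} (hS : ∀ i ≤ n, f i ∈ S) : ReachIn G S n (f 0) (f n) := by
  induction n with
  | zero => exact .refl (hS 0 le_rfl) 0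
  | succ n ih =>
    exact (ih (fun i hi => h i (by omega)) (fun i hi => hS i (by omega))).trans
      (.of_eq_or_adj (h n (by omega)) (hS n (by omega)) (hS (n + 1) le_rfl))

theorem ReachIn.exists_path {S : Set V} {a b : V} {L : ℕ} (h : ReachIn G S L a b) :
    ∃ p : G.Path a b, p.1.length ≤ L ∧ ∀ x ∈ p.1.support, x ∈ S := by
  classical
  obtain ⟨w, hw, hS⟩ := h
  exact ⟨w.toPath, (w.length_bypass_le_length).trans hw,
    fun x hx => hS x (w.support_bypass_subset_support hx)⟩

end ReachIn

/-! ### Bounding wide distances, and their relation to faults. -/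

section WideDist

variable {V W : Type*} {G : SimpleGraph V} {H : SimpleGraph W}

theorem wideDist_le_of_paths {ι : Type*} [Fintype ι] {β L : ℕ} (hβ : β ≤ Fintype.card ι) {u v : V}
    (p : ι → G.Path u v) (hp : Function.Injective p) (hL : ∀ i, (p i).1.length ≤ L)
    (hdisj : ∀ i j, i ≠ j → ∀ x ∈ (p i).1.support, x ∈ (p j).1.support → x = u ∨ x = v) :
    wideDist G β u v ≤ L := by
  obtain ⟨f⟩ : Nonempty (Fin β ↪ ι) := Function.Embedding.nonempty_of_card_le (by simpa using hβ)
  refine iInf₂_le_of_le (fun i => p (f i)) ⟨hp.comp f.injective, fun i j hij x hx hy =>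
    hdisj _ _ (f.injective.ne hij) x hx hy⟩ (iSup_le fun i => ?_)
  exact_mod_cast hL (f i)

/-- Disjoint regions suffice: two equal paths from disjoint regions would have no inner vertex, so
they would be the edge `uv`. -/
theorem wideDist_le_of_not_adj {ι : Type*} [Fintype ι] {β L : ℕ} (hβ : β ≤ Fintype.card ι)
    {u v : V} (huv : u ≠ v) (hadj : ¬ G.Adj u v) (S : ι → Set V)
    (hS : ∀ i, ReachIn G (S i) L u v)
    (hdisj : ∀ i j, i ≠ j → ∀ x ∈ S i, x ∈ S j → x = u ∨ x = v) :
    wideDist G β u v ≤ L := by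
  choose p hpL hpS using fun i => (hS i).exists_path
  refine wideDist_le_of_paths hβ p (fun i j hij => ?_) hpL
    fun i j hij x hx hy => hdisj i j hij x (hpS i x hx) (hpS j x hy)
  by_contra hne
  have key : ∀ x ∈ (p i).1.support, x = u ∨ x = v := fun x hx =>
    hdisj i j hne x (hpS i x hx) (hpS j x (hij ▸ hx))
  generalize (p i).1 = w at key
  cases w with
  | nil => exact huv rfl
  | cons h q =>
    rcases key _ (List.mem_cons_of_mem _ q.start_mem_support) with rfl | rfl
    · exact G.irrefl h
    · exact hadj h

/-- The variant for possibly adjacent `u`, `v`. Equal paths have equal second vertices, which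
disjointness forces to be `v`, and `hev` permits the edge `uv` only once. -/
theorem wideDist_le_of_fst {ι : Type*} [Fintype ι] {β L : ℕ} (hβ : β ≤ Fintype.card ι)
    {u v : V} (e : ι → V) (T : ι → Set V) (hadj : ∀ i, G.Adj u (e i))
    (hT : ∀ i, ReachIn G (T i) L (e i) v) (hu : ∀ i, u ∉ T i)
    (hdisj : ∀ i j, i ≠ j → ∀ x ∈ T i, x ∈ T j → x = v)
    (hev : ∀ i j, e i = v → e j = v → i = j) :
    wideDist G β u v ≤ (L + 1 : ℕ) := by
  choose p hpL hpS using fun i => (hT i).exists_path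
  have hpu : ∀ i, u ∉ (p i).1.support := fun i h => hu i (hpS i u h)
  refine wideDist_le_of_paths hβ (fun i => ⟨.cons (hadj i) (p i).1, (p i).2.cons (hpu i)⟩)
    (fun i j hij => ?_) (fun i => by simpa using hpL i) ?_
  · by_contra hne
    have hsup : ∀ k, (SimpleGraph.Walk.cons (hadj k) (p k).1).snd = e k := fun k => by simp
    have h : e i = e j := by
      rw [← hsup i, ← hsup j]
      exact congrArg (fun q : G.Path u v => q.1.snd) hij
    have hi : e i = v := hdisj i j hne _ (hT i).left_mem (h ▸ (hT j).left_mem)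
    exact hne (hev i j hi (h ▸ hi))
  · intro i j hij x hx hy
    simp only [SimpleGraph.Walk.support_cons, List.mem_cons] at hx hy
    rcases hx with rfl | hx
    · exact Or.inl rfl
    rcases hy with rfl | hy
    · exact Or.inl rfl
    exact Or.inr (hdisj i j hij x (hpS i x hx) (hpS j x hy))

theorem wideDist_le_of_iso (φ : G ≃g H) (β : ℕ) (u v : V) :
    wideDist G β u v ≤ wideDist H β (φ u) (φ v) := by
  refine le_iInf₂ fun P hP => ?_
  have hfix : ∀ x, φ.symm (φ x) = x := fun x => φ.symm_apply_apply x
  let f : H →g G := φ.symm.toHom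
  have hf : Function.Injective f := φ.symm.injective
  have hu : f (φ u) = u := hfix u
  have hv : f (φ v) = v := hfix v
  refine iInf₂_le_of_le (fun i => ⟨((P i).1.map f).copy hu hv, by
      rw [SimpleGraph.Walk.isPath_copy]
      exact (P i).2.map hf⟩) ⟨fun i j hij => ?_, ?_⟩ ?_
  · have h := congrArg (fun q : G.Path u v => q.1.support) hij
    simp only [SimpleGraph.Walk.support_copy, SimpleGraph.Walk.support_map] at h
    exact hP.1 (Subtype.ext (SimpleGraph.Walk.ext_support (List.map_injective_iff.2 hf h)))
  · intro i j hij x hx hy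
    simp only [SimpleGraph.Walk.support_copy, SimpleGraph.Walk.support_map, List.mem_map] at hx hy
    obtain ⟨a, ha, rfl⟩ := hx
    obtain ⟨b, hb, hab⟩ := hy
    obtain rfl := hf hab
    rcases hP.2 i j hij b ha hb with rfl | rfl
    · exact Or.inl hu
    · exact Or.inr hv
  · refine iSup_mono fun i => ?_
    simp

/-- A family of `β + 1` internally disjoint paths survives the deletion of `β` vertices. -/
theorem faultDiam_le_wideDiam (G : SimpleGraph V) (β : ℕ) :
    faultDiam G β ≤ wideDiam G (β + 1) := by
  classical
  refine iSup_mono fun u => iSup_mono fun v => iSup_mono fun huv => ?_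
  refine iSup_le fun F => iSup_le fun hF => iSup_le fun hu => iSup_le fun hv => ?_
  refine le_iInf₂ fun P hP => ?_
  obtain ⟨i, hi⟩ : ∃ i, ∀ x ∈ (P i).1.support, x ∈ {x : V | x ∉ F} := by
    -- Pigeonhole: a fault on each of the `β + 1` paths would give `β + 1` distinct faults, since a
    -- shared one would be `u` or `v`.
    by_contra! hcon
    choose f hfP hfF using hcon
    have hfF' : ∀ i, f i ∈ F := fun i => by simpa using hfF i
    have hinj : Function.Injective f := by
      intro i j hij
      by_contra hne
      rcases hP.2 i j hne (f i) (hfP i) (hij ▸ hfP j) with h | h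
      · exact hu (h ▸ hfF' i)
      · exact hv (h ▸ hfF' i)
    have := Finset.card_le_card_of_injOn (s := Finset.univ) f (fun i _ => hfF' i) hinj.injOn
    simp [hF] at this
  refine le_iSup_of_le i ?_
  have hlen : ((P i).1.induce _ hi).length = (P i).1.length :=
    (SimpleGraph.Walk.length_map _ _).symm.trans
      (congrArg SimpleGraph.Walk.length ((P i).1.map_induce hi))
  rw [← hlen]
  exact ((P i).1.induce _ hi).edist_le

end WideDist

/-! ### Disjoint paths inside one ternary Hamming cube. -/

section HammingGraph

/-- The graph of ternary strings of length `a`, adjacent when they differ in one place. -/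
def ternaryCube (a : ℕ) : SimpleGraph (Fin a → Fin 3) where
  Adj x y := hammingDist x y = 1
  symm := ⟨fun x y h => by rwa [hammingDist_comm]⟩
  loopless := ⟨fun x h => by simp at h⟩

variable {a : ℕ} {x y x' : Fin a → Fin 3}

theorem ternaryCube_adj_of_eq_off (h : x ≠ y) (i : Fin a) (hi : ∀ j, j ≠ i → x j = y j) :
    (ternaryCube a).Adj x y := by
  have hsub : ({j | x j ≠ y j} : Finset (Fin a)) ⊆ {i} := by
    intro j hj
    by_contra hne
    exact (Finset.mem_filter.1 hj).2 (hi j (by simpa using hne))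
  have hpos := hammingDist_pos.2 h
  have hle := Finset.card_le_card hsub
  rw [Finset.card_singleton] at hle
  exact le_antisymm hle hpos

theorem eq_or_ternaryCube_adj (i : Fin a) (hi : ∀ j, j ≠ i → x j = y j) :
    x = y ∨ (ternaryCube a).Adj x y := by
  by_cases h : x = y
  · exact Or.inl h
  · exact Or.inr (ternaryCube_adj_of_eq_off h i hi)

theorem exists_eq_update_of_ternaryCube_adj (h : (ternaryCube a).Adj x y) :
    ∃ i, x i ≠ y i ∧ y = Function.update x i (y i) := by
  obtain ⟨i, hi⟩ := Finset.card_eq_one.1 (show Finset.card {j | x j ≠ y j} = 1 from h)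
  have hmem : ∀ j, x j ≠ y j ↔ j = i := fun j => by
    simpa using congrArg (j ∈ ·) hi
  refine ⟨i, (hmem i).2 rfl, funext fun j => ?_⟩
  by_cases hj : j = i
  · subst hj; simp
  · rw [Function.update_of_ne hj]
    exact (not_not.1 (mt (hmem j).1 hj)).symm

/-- The number of cyclic steps from position `i` to position `j`. -/
def cyclicOffset (i j : Fin a) : ℕ := if i.1 ≤ j.1 then j.1 - i.1 else a + j.1 - i.1

theorem cyclicOffset_lt (i j : Fin a) : cyclicOffset i j < a := by
  unfold cyclicOffset; split_ifs <;> omega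

theorem cyclicOffset_injective (i : Fin a) : Function.Injective (cyclicOffset i) := by
  intro j k h
  unfold cyclicOffset at h
  ext
  split_ifs at h <;> omega

/-- The arcs from `i` to `k` and from `k` to `i` cover the circle. -/
theorem cyclicOffset_le_or {i k : Fin a} (h : i ≠ k) (j : Fin a) :
    cyclicOffset i j ≤ cyclicOffset i k ∨ cyclicOffset k j ≤ cyclicOffset k i := by
  have h' : i.1 ≠ k.1 := Fin.val_ne_of_ne h
  unfold cyclicOffset; split_ifs <;> omega

/-- The string that has the value `c` in position `i`, agrees with `x'` in the next `n` positions
in cyclic order, and with `x` in the remaining ones. -/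
def cyclicMix (x x' : Fin a → Fin 3) (i : Fin a) (c : Fin 3) (n : ℕ) : Fin a → Fin 3 := fun j =>
  if j = i then c else if cyclicOffset i j ≤ n then x' j else x j

theorem cyclicMix_self {i : Fin a} {c : Fin 3} {n : ℕ} : cyclicMix x x' i c n i = c := by
  simp [cyclicMix]

theorem cyclicMix_zero (i : Fin a) (c : Fin 3) : cyclicMix x x' i c 0 = Function.update x i c := by
  funext j
  by_cases hj : j = i
  · subst hj; simp [cyclicMix]
  · have : cyclicOffset i j ≠ 0 := fun h => hj
      (cyclicOffset_injective i (h.trans (by simp [cyclicOffset])))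
    simp [cyclicMix, hj, this]

theorem cyclicMix_succ (i : Fin a) (c : Fin 3) (n : ℕ) :
    cyclicMix x x' i c n = cyclicMix x x' i c (n + 1) ∨
      (ternaryCube a).Adj (cyclicMix x x' i c n) (cyclicMix x x' i c (n + 1)) := by
  by_cases h : ∃ k, cyclicOffset i k = n + 1
  · obtain ⟨k, hk⟩ := h
    refine eq_or_ternaryCube_adj k fun j hj => ?_
    have : cyclicOffset i j ≠ n + 1 := fun h => hj (cyclicOffset_injective i (h.trans hk.symm))
    have hiff : cyclicOffset i j ≤ n + 1 ↔ cyclicOffset i j ≤ n := by omega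
    simp only [cyclicMix, hiff]
  · refine Or.inl (funext fun j => ?_)
    have : cyclicOffset i j ≠ n + 1 := fun hj => h ⟨j, hj⟩
    have hiff : cyclicOffset i j ≤ n + 1 ↔ cyclicOffset i j ≤ n := by omega
    simp only [cyclicMix, hiff]

theorem cyclicMix_last (i : Fin a) (c : Fin 3) :
    cyclicMix x x' i c (a - 1) = x' ∨ (ternaryCube a).Adj (cyclicMix x x' i c (a - 1)) x' := by
  refine eq_or_ternaryCube_adj i fun j hj => ?_
  have : cyclicOffset i j ≤ a - 1 := by have := cyclicOffset_lt i j; omega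
  simp [cyclicMix, hj, this]

/-- At a common string, position `i` holds `c ≠ x i`, so the rewriting that started at `k` has
already passed `i`; likewise the other has passed `k`. The two rewritten arcs cover the circle, so
every entry is that of `x'`. -/
theorem cyclicMix_eq {i k : Fin a} {c d : Fin 3} {m n : ℕ} (hc : c ≠ x i) (hd : d ≠ x k)
    (hik : (i, c) ≠ (k, d)) (h : cyclicMix x x' i c m = cyclicMix x x' k d n) :
    cyclicMix x x' i c m = x' := by
  have hne : i ≠ k := by
    rintro rfl
    have := congrFun h i
    rw [cyclicMix_self, cyclicMix_self] at this
    exact hik (by rw [this])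
  have hi : cyclicOffset k i ≤ n ∧ c = x' i := by
    have := congrFun h i
    rw [cyclicMix_self] at this
    simp only [cyclicMix, hne, if_false] at this
    split_ifs at this with h1
    · exact ⟨h1, this⟩
    · exact absurd this hc
  have hk : cyclicOffset i k ≤ m ∧ d = x' k := by
    have := (congrFun h k).symm
    rw [cyclicMix_self] at this
    simp only [cyclicMix, hne.symm, if_false] at this
    split_ifs at this with h1
    · exact ⟨h1, this⟩
    · exact absurd this hd
  funext j
  rcases cyclicOffset_le_or hne j with hj | hj
  · have hj' : cyclicOffset i j ≤ m := hj.trans hk.1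
    by_cases hji : j = i
    · subst hji; rw [cyclicMix_self]; exact hi.2
    · simp [cyclicMix, hji, hj']
  · rw [h]
    have hj' : cyclicOffset k j ≤ n := hj.trans hi.1
    by_cases hjk : j = k
    · subst hjk; rw [cyclicMix_self]; exact hk.2
    · simp [cyclicMix, hjk, hj']

theorem ternaryCube_reachIn (x y : Fin a → Fin 3) : ReachIn (ternaryCube a) Set.univ a x y := by
  rcases Nat.eq_zero_or_pos a with rfl | ha
  · rw [Subsingleton.elim x y]
    exact .refl (Set.mem_univ _) 0
  -- Writing the correct value at the start makes a final correction of that entry unnecessary, so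
  -- `1 + (a - 1)` moves suffice.
  have h0 : cyclicMix x y ⟨0, ha⟩ (y ⟨0, ha⟩) (a - 1) = y := by
    funext j
    by_cases hj : j = ⟨0, ha⟩
    · subst hj; rw [cyclicMix_self]
    · have : cyclicOffset ⟨0, ha⟩ j ≤ a - 1 := by have := cyclicOffset_lt ⟨0, ha⟩ j; omega
      simp [cyclicMix, hj, this]
  have h1 := ReachIn.of_seq (G := ternaryCube a) (cyclicMix x y ⟨0, ha⟩ (y ⟨0, ha⟩)) (a - 1)
    (fun i _ => cyclicMix_succ _ _ i) (S := Set.univ) (fun _ _ => Set.mem_univ _)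
  rw [h0, cyclicMix_zero] at h1
  refine ((ReachIn.of_eq_or_adj (eq_or_ternaryCube_adj ⟨0, ha⟩ fun j hj => ?_)
    (Set.mem_univ _) (Set.mem_univ _)).trans h1).mono subset_rfl (by omega)
  rw [Function.update_of_ne hj]

/-- Supplies the reserved block value for an extra path. If `x` and `y` differ in an entry, the
third letter of the alphabet is put there. -/
theorem exists_third_vertex (ha : 1 ≤ a) (x y : Fin a → Fin 3) :
    ∃ z, z ≠ x ∧ z ≠ y ∧ ((ternaryCube a).Adj z y) := by
  by_cases h : x = y
  · subst h
    have hne : Function.update x ⟨0, ha⟩ (x ⟨0, ha⟩ + 1) ≠ x := fun h => by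
      have := congrFun h ⟨0, ha⟩
      simp at this
    exact ⟨_, hne, hne, ternaryCube_adj_of_eq_off hne ⟨0, ha⟩ fun j hj => by simp [hj]⟩
  · obtain ⟨i, hi⟩ := Function.ne_iff.1 h
    obtain ⟨c, hcx, hcy⟩ : ∃ c : Fin 3, c ≠ x i ∧ c ≠ y i := by
      generalize x i = p
      generalize y i = q
      revert p q
      decide
    have hy : Function.update y i c ≠ y := fun h => hcy (by simpa using congrFun h i)
    exact ⟨Function.update y i c, fun h => hcx (by simpa using congrFun h i), hy,
      ternaryCube_adj_of_eq_off hy i fun j hj => by simp [hj]⟩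

/-- The neighbours of `x`, numbered by a position and one of the two other values there. -/
def ternaryNbr (x : Fin a → Fin 3) (k : Fin a × Fin 2) : Fin a → Fin 3 :=
  Function.update x k.1 (x k.1 + k.2.succ)

theorem add_succ_ne (p : Fin 3) (c : Fin 2) : p + c.succ ≠ p := by
  revert p c; decide

theorem ternaryNbr_injective (x : Fin a → Fin 3) : Function.Injective (ternaryNbr x) := by
  rintro ⟨i, c⟩ ⟨k, d⟩ h
  have hi := congrFun h i
  simp only [ternaryNbr, Function.update_self] at hi
  by_cases hik : i = k
  · subst hik
    simp only [Function.update_self] at hi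
    have := Fin.succ_injective _ (add_left_cancel hi)
    rw [this]
  · rw [Function.update_of_ne hik] at hi
    exact absurd hi (add_succ_ne _ _)

theorem ternaryCube_adj_ternaryNbr (x : Fin a → Fin 3) (k : Fin a × Fin 2) :
    (ternaryCube a).Adj x (ternaryNbr x k) := by
  refine ternaryCube_adj_of_eq_off (fun h => ?_) k.1 fun j hj => by simp [ternaryNbr, hj]
  have := congrFun h k.1
  simp only [ternaryNbr, Function.update_self] at this
  exact add_succ_ne _ _ this.symm

theorem exists_add_succ {p q : Fin 3} (h : p ≠ q) : ∃ c : Fin 2, q = p + c.succ := by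
  revert p q; decide

theorem exists_ternaryNbr_eq (h : (ternaryCube a).Adj x y) : ∃ k, ternaryNbr x k = y := by
  obtain ⟨i, hi, hy⟩ := exists_eq_update_of_ternaryCube_adj h
  obtain ⟨c, hc⟩ := exists_add_succ hi
  exact ⟨(i, c), by rw [hy, ternaryNbr, ← hc]⟩

/-- `2 * a` internally disjoint paths from `x` to `x'`, given by their second vertices `E k` and
the vertex sets `P k` of their remaining parts. -/
theorem exists_ternaryCube_fan (ha : 1 ≤ a) (x x' : Fin a → Fin 3) :
    ∃ (o : Fin (2 * a)) (E : Fin (2 * a) → Fin a → Fin 3) (P : Fin (2 * a) → Set (Fin a → Fin 3)),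
      Function.Injective E ∧ (∀ k, (ternaryCube a).Adj x (E k)) ∧
      (∀ k, ReachIn (ternaryCube a) (P k) a (E k) x') ∧
      (∀ k l, k ≠ l → ∀ w ∈ P k, w ∈ P l → w = x') ∧
      (∀ k, x ∈ P k → x = x') ∧ ∀ k, k ≠ o → E k ≠ x' := by
  have e : Fin (2 * a) ≃ Fin a × Fin 2 := (finCongr (mul_comm 2 a)).trans finProdFinEquiv.symm
  -- `o` is the index of the neighbour `x'` if there is one, and arbitrary otherwise.
  obtain ⟨o, ho⟩ : ∃ o, ∀ k, k ≠ o → ternaryNbr x k ≠ x' := by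
    by_cases h : ∃ o, ternaryNbr x o = x'
    · obtain ⟨o, ho⟩ := h
      exact ⟨o, fun k hk h => hk (ternaryNbr_injective x (h.trans ho.symm))⟩
    · exact ⟨(⟨0, ha⟩, 0), fun k _ hk => h ⟨k, hk⟩⟩
  let R : Fin a × Fin 2 → ℕ → Fin a → Fin 3 := fun k => cyclicMix x x' k.1 (x k.1 + k.2.succ)
  let P : Fin a × Fin 2 → Set (Fin a → Fin 3) := fun k => insert x' (Set.range (R k))
  have hR : ∀ k, R k 0 = ternaryNbr x k := fun k => cyclicMix_zero _ _
  have hP : ∀ k l, k ≠ l → ∀ w ∈ P k, w ∈ P l → w = x' := by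
    rintro ⟨i, c⟩ ⟨j, d⟩ hkl w (rfl | ⟨m, rfl⟩)
    · exact fun _ => rfl
    rintro (h | ⟨n, hn⟩)
    · exact h
    · refine cyclicMix_eq (add_succ_ne _ _) (add_succ_ne _ _) (fun h => hkl ?_) hn.symm
      simp only [Prod.mk.injEq] at h ⊢
      obtain ⟨rfl, h⟩ := h
      exact ⟨rfl, Fin.succ_injective _ (add_left_cancel h)⟩
  refine ⟨e.symm o, fun k => ternaryNbr x (e k), fun k => P (e k),
    (ternaryNbr_injective x).comp e.injective, fun k => ternaryCube_adj_ternaryNbr x _, fun k => ?_,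
    fun k l hkl => hP _ _ (e.injective.ne hkl), fun k => ?_, fun k hk => ho _ ?_⟩
  · show ReachIn _ _ _ (ternaryNbr x (e k)) x'
    have h := ReachIn.of_seq (G := ternaryCube a) (R (e k)) (a - 1)
      (fun i _ => cyclicMix_succ _ _ i) (S := P (e k))
      (fun i _ => Set.mem_insert_of_mem _ (Set.mem_range_self i))
    rw [hR] at h
    exact (h.trans (.of_eq_or_adj (cyclicMix_last _ _) h.right_mem
      (Set.mem_insert _ _))).mono subset_rfl (by omega)
  · rintro (h | ⟨n, hn⟩)
    · exact h
    · have := congrFun hn (e k).1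
      simp only [R, cyclicMix_self] at this
      exact absurd this (add_succ_ne _ _)
  · rintro rfl
    simp at hk

/-- Vertices `e k` of the closed neighbourhood of `x` other than `x'`, with paths to `x'` that
meet only in `x'`, and a path from `x` to `x'` that avoids the `e k ≠ x`. -/
theorem exists_ternaryCube_closedFan (ha : 1 ≤ a) (x x' : Fin a → Fin 3) :
    ∃ (e : Fin (2 * a) → Fin a → Fin 3) (P : Fin (2 * a) → Set (Fin a → Fin 3))
      (Q : Set (Fin a → Fin 3)),
      Function.Injective e ∧ (∀ k, x = e k ∨ (ternaryCube a).Adj x (e k)) ∧ (∀ k, e k ≠ x') ∧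
      (∀ k, ReachIn (ternaryCube a) (P k) (a + 1) (e k) x') ∧
      (∀ k l, k ≠ l → ∀ w ∈ P k, w ∈ P l → w = x') ∧
      ReachIn (ternaryCube a) Q (a + 1) x x' ∧ ∀ k, e k ∈ Q → e k = x := by
  obtain ⟨o, E, P, hE, hadj, hR, hP, hx, ho⟩ := exists_ternaryCube_fan ha x x'
  by_cases h : x = x'
  · subst h
    exact ⟨E, P, {x}, hE, fun k => Or.inr (hadj k), fun k => (hadj k).ne',
      fun k => (hR k).mono subset_rfl (by omega), hP, .refl (Set.mem_singleton x) _, fun k hk => hk⟩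
  have hxP : ∀ k, x ∉ P k := fun k hk => h (hx k hk)
  have hxE : ∀ k, x ≠ E k := fun k => (hadj k).ne
  have hQ : ReachIn (ternaryCube a) (insert x (P o)) (a + 1) x x' :=
    ((ReachIn.of_adj (hadj o) (Set.mem_insert _ _)
      (Set.mem_insert_of_mem _ (hR o).left_mem)).trans
      ((hR o).mono (Set.subset_insert _ _) le_rfl)).mono subset_rfl (by omega)
  -- The start `E o`, which may be `x'`, is replaced by `x` itself; its path becomes one step
  -- longer, and `Q` is the same path.
  refine ⟨fun k => if k = o then x else E k, fun k => if k = o then insert x (P o) else P k,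
    insert x (P o), fun k l hkl => ?_, fun k => ?_, fun k => ?_, fun k => ?_, fun k l hkl w => ?_,
    hQ, fun k => ?_⟩
  · dsimp only at hkl
    split_ifs at hkl with h1 h2 h2
    · rw [h1, h2]
    · exact absurd hkl (hxE l)
    · exact absurd hkl.symm (hxE k)
    · exact hE hkl
  · dsimp only
    split_ifs
    · exact Or.inl rfl
    · exact Or.inr (hadj k)
  · dsimp only
    split_ifs with h1
    · exact h
    · exact ho k h1
  · dsimp only
    split_ifs
    · exact hQ
    · exact (hR k).mono subset_rfl (by omega)
  · dsimp only
    split_ifs with h1 h2 h2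
    · exact absurd (h1.trans h2.symm) hkl
    · rintro (rfl | h3) h4
      · exact absurd h4 (hxP l)
      · exact hP o l (Ne.symm h2) w h3 h4
    · rintro h4 (rfl | h3)
      · exact absurd h4 (hxP k)
      · exact hP o k (Ne.symm h1) w h3 h4
    · exact hP k l hkl w
  · dsimp only
    split_ifs with h1
    · exact fun _ => rfl
    · rintro (h2 | h2)
      · exact h2
      · exact absurd (hP o k (Ne.symm h1) _ h2 (hR k).left_mem) (ho k h1)

end HammingGraph

/-! ### Adding one or two exceptional paths to a family. -/

section WideDistOption

variable {V : Type*} {G : SimpleGraph V}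

theorem forall_ne_option {J : Type*} {α : Type*} {S : J → α} {A : α} {D : α → α → Prop}
    (hD : ∀ s t, D s t → D t s) (hS : ∀ i j, i ≠ j → D (S i) (S j)) (hA : ∀ i, D (S i) A) :
    ∀ i j : Option J, i ≠ j → D (i.elim A S) (j.elim A S) := by
  rintro (_ | i) (_ | j) h
  · exact absurd rfl h
  · exact hD _ _ (hA j)
  · exact hA i
  · exact hS i j fun hij => h (by rw [hij])

theorem wideDist_le_of_option {J : Type*} [Fintype J] {β L : ℕ} (hβ : β ≤ Fintype.card J + 1)
    {u v : V} (huv : u ≠ v) (hadj : ¬ G.Adj u v) (S : J → Set V) (A : Set V)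
    (hS : ∀ i, ReachIn G (S i) L u v) (hA : ReachIn G A L u v)
    (hSS : ∀ i j, i ≠ j → ∀ x ∈ S i, x ∈ S j → x = u ∨ x = v)
    (hSA : ∀ i, ∀ x ∈ S i, x ∈ A → x = u ∨ x = v) :
    wideDist G β u v ≤ L := by
  refine wideDist_le_of_not_adj (ι := Option J) (by simpa using hβ) huv hadj
    (fun o => o.elim A S) (fun o => by cases o; exacts [hA, hS _])
    (forall_ne_option (D := fun S T => ∀ x ∈ S, x ∈ T → x = u ∨ x = v)
      (fun s t h x hx hy => h x hy hx) hSS hSA)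

theorem wideDist_le_of_option_option {J : Type*} [Fintype J] {β L : ℕ}
    (hβ : β ≤ Fintype.card J + 2) {u v : V} (huv : u ≠ v) (hadj : ¬ G.Adj u v) (S : J → Set V)
    (A B : Set V) (hS : ∀ i, ReachIn G (S i) L u v) (hA : ReachIn G A L u v)
    (hB : ReachIn G B L u v) (hSS : ∀ i j, i ≠ j → ∀ x ∈ S i, x ∈ S j → x = u ∨ x = v)
    (hSA : ∀ i, ∀ x ∈ S i, x ∈ A → x = u ∨ x = v)
    (hSB : ∀ i, ∀ x ∈ S i, x ∈ B → x = u ∨ x = v)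
    (hAB : ∀ x ∈ A, x ∈ B → x = u ∨ x = v) :
    wideDist G β u v ≤ L := by
  refine wideDist_le_of_option (J := Option J) (by rw [Fintype.card_option]; omega) huv hadj
    (fun o => o.elim A S) B (fun o => by cases o; exacts [hA, hS _]) hB
    (forall_ne_option (D := fun S T => ∀ x ∈ S, x ∈ T → x = u ∨ x = v)
      (fun s t h x hx hy => h x hy hx) hSS hSA) (fun o => by cases o; exacts [hAB, hSB _])

end WideDistOption

/-! ### Elementary moves in the exchanged cube. -/

section Moves

variable {r s t : ℕ}

/-- The set of vertices `ABCd` for which the predicate on `A`, `B`, `C` that belongs to `d`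
holds. -/
def layered (P₂ P₁ P₀ : (Fin r → Fin 3) → (Fin s → Fin 3) → (Fin t → Fin 3) → Prop) :
    Set (E3CVertex r s t) :=
  {p | (p.2.2.2 = 2 ∧ P₂ p.1 p.2.1 p.2.2.1) ∨ (p.2.2.2 = 1 ∧ P₁ p.1 p.2.1 p.2.2.1) ∨
    (p.2.2.2 = 0 ∧ P₀ p.1 p.2.1 p.2.2.1)}

variable {P₂ P₁ P₀ : (Fin r → Fin 3) → (Fin s → Fin 3) → (Fin t → Fin 3) → Prop}
  {x x' : Fin r → Fin 3} {y y' : Fin s → Fin 3} {z z' : Fin t → Fin 3} {d d' : Fin 3}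
  {S : Set (E3CVertex r s t)} {L : ℕ}

@[simp] theorem mem_layered_two : (x, y, z, 2) ∈ layered P₂ P₁ P₀ ↔ P₂ x y z := by simp [layered]

@[simp] theorem mem_layered_one : (x, y, z, 1) ∈ layered P₂ P₁ P₀ ↔ P₁ x y z := by simp [layered]

@[simp] theorem mem_layered_zero : (x, y, z, 0) ∈ layered P₂ P₁ P₀ ↔ P₀ x y z := by simp [layered]

theorem E3CVertex.forall {Q : E3CVertex r s t → Prop} (h₂ : ∀ x y z, Q (x, y, z, 2))
    (h₁ : ∀ x y z, Q (x, y, z, 1)) (h₀ : ∀ x y z, Q (x, y, z, 0)) : ∀ p, Q p := by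
  rintro ⟨x, y, z, d⟩
  match d with
  | 0 => exact h₀ x y z
  | 1 => exact h₁ x y z
  | 2 => exact h₂ x y z

theorem E3C_adj : (E3C r s t).Adj (x, y, z, d) (x', y', z', d') ↔
    (x = x' ∧ y = y' ∧ z = z' ∧ d ≠ d') ∨
    (x = x' ∧ y = y' ∧ hammingDist z z' = 1 ∧ d = 0 ∧ d' = 0) ∨
    (x = x' ∧ hammingDist y y' = 1 ∧ z = z' ∧ d = 1 ∧ d' = 1) ∨
    (hammingDist x x' = 1 ∧ y = y' ∧ z = z' ∧ d = 2 ∧ d' = 2) := Iff.rfl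

theorem ReachIn.switch (hd : d ≠ d') (h : (x, y, z, d) ∈ S) (h' : (x, y, z, d') ∈ S) :
    ReachIn (E3C r s t) S 1 (x, y, z, d) (x, y, z, d') :=
  .of_adj (Or.inl ⟨rfl, rfl, rfl, hd⟩) h h'

/-- The inclusion of the cube of the vertices `AyZ2`. -/
def cubeHom₂ (y : Fin s → Fin 3) (z : Fin t → Fin 3) : ternaryCube r →g E3C r s t where
  toFun x := (x, y, z, 2)
  map_rel' h := Or.inr (Or.inr (Or.inr ⟨h, rfl, rfl, rfl, rfl⟩))

/-- The inclusion of the cube of the vertices `xBz1`. -/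
def cubeHom₁ (x : Fin r → Fin 3) (z : Fin t → Fin 3) : ternaryCube s →g E3C r s t where
  toFun y := (x, y, z, 1)
  map_rel' h := Or.inr (Or.inr (Or.inl ⟨rfl, h, rfl, rfl, rfl⟩))

/-- The inclusion of the cube of the vertices `xyC0`. -/
def cubeHom₀ (x : Fin r → Fin 3) (y : Fin s → Fin 3) : ternaryCube t →g E3C r s t where
  toFun z := (x, y, z, 0)
  map_rel' h := Or.inr (Or.inl ⟨rfl, rfl, h, rfl, rfl⟩)

theorem ReachIn.cube₂ {P : Set (Fin r → Fin 3)} (h : ReachIn (ternaryCube r) P L x x')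
    (hP : ∀ w ∈ P, (w, y, z, 2) ∈ S) : ReachIn (E3C r s t) S L (x, y, z, 2) (x', y, z, 2) :=
  h.map (cubeHom₂ y z) hP

theorem ReachIn.cube₁ {P : Set (Fin s → Fin 3)} (h : ReachIn (ternaryCube s) P L y y')
    (hP : ∀ w ∈ P, (x, w, z, 1) ∈ S) : ReachIn (E3C r s t) S L (x, y, z, 1) (x, y', z, 1) :=
  h.map (cubeHom₁ x z) hP

theorem ReachIn.cube₀ {P : Set (Fin t → Fin 3)} (h : ReachIn (ternaryCube t) P L z z')
    (hP : ∀ w ∈ P, (x, y, w, 0) ∈ S) : ReachIn (E3C r s t) S L (x, y, z, 0) (x, y, z', 0) :=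
  h.map (cubeHom₀ x y) hP

theorem ReachIn.travel₂ (x x') (h : ∀ w, (w, y, z, 2) ∈ S) :
    ReachIn (E3C r s t) S r (x, y, z, 2) (x', y, z, 2) :=
  (ternaryCube_reachIn x x').cube₂ fun w _ => h w

theorem ReachIn.travel₁ (y y') (h : ∀ w, (x, w, z, 1) ∈ S) :
    ReachIn (E3C r s t) S s (x, y, z, 1) (x, y', z, 1) :=
  (ternaryCube_reachIn y y').cube₁ fun w _ => h w

theorem ReachIn.travel₀ (z z') (h : ∀ w, (x, y, w, 0) ∈ S) :
    ReachIn (E3C r s t) S t (x, y, z, 0) (x, y, z', 0) :=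
  (ternaryCube_reachIn z z').cube₀ fun w _ => h w

theorem ReachIn.step₂ (h : x = x' ∨ (ternaryCube r).Adj x x') (h1 : (x, y, z, 2) ∈ S)
    (h2 : (x', y, z, 2) ∈ S) : ReachIn (E3C r s t) S 1 (x, y, z, 2) (x', y, z, 2) :=
  (ReachIn.of_eq_or_adj (S := {w | (w, y, z, 2) ∈ S}) h h1 h2).cube₂ fun _ h => h

theorem ReachIn.step₁ (h : y = y' ∨ (ternaryCube s).Adj y y') (h1 : (x, y, z, 1) ∈ S)
    (h2 : (x, y', z, 1) ∈ S) : ReachIn (E3C r s t) S 1 (x, y, z, 1) (x, y', z, 1) :=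
  (ReachIn.of_eq_or_adj (S := {w | (x, w, z, 1) ∈ S}) h h1 h2).cube₁ fun _ h => h

theorem ReachIn.step₀ (h : z = z' ∨ (ternaryCube t).Adj z z') (h1 : (x, y, z, 0) ∈ S)
    (h2 : (x, y, z', 0) ∈ S) : ReachIn (E3C r s t) S 1 (x, y, z, 0) (x, y, z', 0) :=
  (ReachIn.of_eq_or_adj (S := {w | (x, y, w, 0) ∈ S}) h h1 h2).cube₀ fun _ h => h

end Moves

/-! ### From layer 2 to layer 1 with different `C` blocks. -/

section Cases

variable {r s t m : ℕ}

/-- Distinct numberings of the closed neighbourhood of `x`: `e none = x`, and one further vertex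
`e (some o)` differs from `x'`. -/
theorem exists_closedNbhd (hm : 1 ≤ m) (hr : m ≤ r) (x x' : Fin r → Fin 3) (o : Fin (2 * m)) :
    ∃ e : Option (Fin (2 * m)) → Fin r → Fin 3, Function.Injective e ∧ e none = x ∧
      (∀ k, x = e k ∨ (ternaryCube r).Adj x (e k)) ∧ e (some o) ≠ x' := by
  obtain ⟨p, E, -, hE, hadj, -, -, -, hp⟩ := exists_ternaryCube_fan (hm.trans hr) x x'
  obtain ⟨q, hq⟩ : ∃ q, q ≠ p := by
    have : Nontrivial (Fin (2 * r)) := Fin.nontrivial_iff_two_le.2 (by omega)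
    exact exists_ne p
  let f : Fin (2 * m) → Fin (2 * r) := Fin.castLE (by omega)
  have hf : Function.Injective f := Fin.castLE_injective _
  -- Only `E p` can be `x'`; the transposition gives index `o` the neighbour `E q` with `q ≠ p`.
  refine ⟨fun k => k.elim x fun i => E (Equiv.swap (f o) q (f i)), ?_, rfl, ?_, ?_⟩
  · rintro (_ | i) (_ | j) h
    · rfl
    · exact absurd h (hadj _).ne
    · exact absurd h (hadj _).ne'
    · rw [hf (Equiv.injective _ (hE h))]
  · rintro (_ | i)
    · exact Or.inl rfl
    · exact Or.inr (hadj _)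
  · simpa using hp q hq

/-- Path `k` is tagged by `e k` while `C = z` and by `f k` once `C = z'`, and by both in layer 0,
where `C` changes. The extra path leaves through layer 0 and changes `B` and `A` at `C = z₁`. Both
kinds have length at most `r + s + t + 6`. -/
theorem wideDist_two_one_of_ne (hm : 1 ≤ m) (hr : m ≤ r) (hs : m ≤ s) (ht : m ≤ t)
    (x x' : Fin r → Fin 3) (y y' : Fin s → Fin 3) {z z' : Fin t → Fin 3} (hz : z ≠ z') :
    wideDist (E3C r s t) (2 * m + 2) (x, y, z, 2) (x', y', z', 1) ≤ (r + s + t + 6 : ℕ) := by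
  obtain ⟨e, he, he0, hadj, heo⟩ := exists_closedNbhd hm hr x x' ⟨0, by omega⟩
  obtain ⟨w, hw, hw0, hwadj, hwo⟩ := exists_closedNbhd hm hs y' y ⟨0, by omega⟩
  generalize (⟨0, by omega⟩ : Fin (2 * m)) = o at *
  obtain ⟨z₁, hz1, hz2, hzadj⟩ := exists_third_vertex (hm.trans ht) z z'
  -- The extra path occupies the layer 0 cubes at `(x, y)` and `(x', y')`, so no tag pair `(e k, f
  -- k)` may equal either. The transposition pairs `e k = x` with some `f k ≠ y`, and `f k = y'`
  -- with some `e k ≠ x'`.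
  let σ := Equiv.swap (none : Option (Fin (2 * m))) (some o)
  obtain ⟨f, hf, hfadj, hfx, hfx'⟩ : ∃ f : Option (Fin (2 * m)) → Fin s → Fin 3,
      Function.Injective f ∧ (∀ k, y' = f k ∨ (ternaryCube s).Adj y' (f k)) ∧
      (∀ k, e k = x → f k ≠ y) ∧ ∀ k, f k = y' → e k ≠ x' := by
    refine ⟨w ∘ σ, hw.comp σ.injective, fun k => hwadj _, fun k hk => ?_, fun k hk => ?_⟩
    · rw [← he0] at hk
      rw [he hk]
      simpa [σ] using hwo
    · rw [← hw0] at hk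
      have : k = some o := by
        have := hw hk
        simpa [σ, Equiv.swap_apply_eq_iff] using this
      rw [this]
      exact heo
  refine wideDist_le_of_option (J := Option (Fin (2 * m))) (by simp) (by simp)
    (by rw [E3C_adj]; simp [hz])
    (fun k => layered
      (fun a b c => (b = y ∧ c = z ∧ (a = x ∨ a = e k)) ∨ (b = f k ∧ c = z'))
      (fun a b c => (a = e k ∧ c = z) ∨ (a = x' ∧ c = z' ∧ (b = f k ∨ b = y')))
      (fun a b c => a = e k ∧ b = f k))
    (layered
      (fun a b c => (a = x ∧ b = y ∧ c = z) ∨ (b = y' ∧ c = z₁))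
      (fun a b c => (a = x ∧ c = z₁) ∨ (a = x' ∧ b = y' ∧ c = z'))
      (fun a b c => (a = x ∧ b = y) ∨ (a = x' ∧ b = y')))
    (fun k => ?_) ?_ ?_ ?_
  · refine ReachIn.mono ((ReachIn.step₂ (hadj k) ?_ ?_).trans <|
      (ReachIn.switch (d' := 1) ?_ ?_ ?_).trans <| (ReachIn.travel₁ y (f k) ?_).trans <|
      (ReachIn.switch (d' := 0) ?_ ?_ ?_).trans <| (ReachIn.travel₀ z z' ?_).trans <|
      (ReachIn.switch (d' := 2) ?_ ?_ ?_).trans <| (ReachIn.travel₂ (e k) x' ?_).trans <|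
      (ReachIn.switch (d' := 1) ?_ ?_ ?_).trans <|
      (ReachIn.step₁ ((hfadj k).imp Eq.symm SimpleGraph.Adj.symm) ?_ ?_))
      subset_rfl (by omega) <;> simp
  · refine ReachIn.mono (
      (ReachIn.switch (d' := 0) ?_ ?_ ?_).trans <| (ReachIn.travel₀ z z₁ ?_).trans <|
      (ReachIn.switch (d' := 1) ?_ ?_ ?_).trans <| (ReachIn.travel₁ y y' ?_).trans <|
      (ReachIn.switch (d' := 2) ?_ ?_ ?_).trans <| (ReachIn.travel₂ x x' ?_).trans <|
      (ReachIn.switch (d' := 0) ?_ ?_ ?_).trans <| (ReachIn.step₀ (Or.inr hzadj) ?_ ?_).trans <|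
      (ReachIn.switch (d' := 1) ?_ ?_ ?_))
      subset_rfl (by omega) <;> simp
  · intro i j hij
    have h1 := he.ne hij
    have h2 := hf.ne hij
    refine E3CVertex.forall ?_ ?_ ?_ <;>
      simp only [mem_layered_two, mem_layered_one, mem_layered_zero, Prod.mk.injEq] <;> grind
  · intro i
    have h1 := hfx i
    have h2 := hfx' i
    refine E3CVertex.forall ?_ ?_ ?_ <;>
      simp only [mem_layered_two, mem_layered_one, mem_layered_zero, Prod.mk.injEq] <;> grind

end Cases

/-! ### The remaining cases, with layers 2 to 1 and 2 to 2. -/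

section EqualBlocks

variable {r s t m : ℕ}

/-- With equal `C` blocks the tagged paths alternate between layers 2 and 1 and never enter layer 0.
One extra path changes `A` and then `B` directly, avoiding the tags; the other makes its changes at
`C = z₁`. -/
theorem wideDist_two_one_of_eq (hm : 1 ≤ m) (hr : m ≤ r) (hs : m ≤ s) (ht : m ≤ t)
    {x x' : Fin r → Fin 3} {y y' : Fin s → Fin 3} (z : Fin t → Fin 3) (hxy : x = x' → y ≠ y') :
    wideDist (E3C r s t) (2 * m + 2) (x, y, z, 2) (x', y', z, 1) ≤ (r + s + t + 6 : ℕ) := by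
  obtain ⟨e, -, P, he, hadj, hex', -, -, hP, heP⟩ := exists_ternaryCube_closedFan (hm.trans hr) x x'
  obtain ⟨f, -, Q, hf, hfadj, hfy, -, -, hQ, hfQ⟩ :=
    exists_ternaryCube_closedFan (hm.trans hs) y' y
  obtain ⟨z₁, -, hz1, hzadj⟩ := exists_third_vertex (hm.trans ht) z z
  let g : Fin (2 * m) → Fin (2 * r) := Fin.castLE (by omega)
  let h : Fin (2 * m) → Fin (2 * s) := Fin.castLE (by omega)
  have hg : Function.Injective g := Fin.castLE_injective _
  have hh : Function.Injective h := Fin.castLE_injective _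
  refine wideDist_le_of_option_option (J := Fin (2 * m)) (by simp) (by simp)
    (by rw [E3C_adj]; simpa using hxy)
    (fun k => layered
      (fun a b c => (b = y ∧ c = z ∧ (a = x ∨ a = e (g k))) ∨ (b = f (h k) ∧ c = z))
      (fun a b c => (a = e (g k) ∧ c = z) ∨ (a = x' ∧ c = z ∧ (b = f (h k) ∨ b = y')))
      (fun _ _ _ => False))
    (layered
      (fun a b c => a ∈ P ∧ b = y ∧ c = z)
      (fun a b c => a = x' ∧ b ∈ Q ∧ c = z)
      (fun _ _ _ => False))
    (layered
      (fun a b c => (a = x ∧ b = y ∧ c = z) ∨ (b = y' ∧ c = z₁))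
      (fun a b c => (a = x ∧ c = z₁) ∨ (a = x' ∧ b = y' ∧ c = z))
      (fun a b c => (a = x ∧ b = y) ∨ (a = x' ∧ b = y')))
    (fun k => ?_) ?_ ?_ ?_ ?_ ?_ ?_
  · refine ReachIn.mono ((ReachIn.step₂ (hadj (g k)) ?_ ?_).trans <|
      (ReachIn.switch (d' := 1) ?_ ?_ ?_).trans <| (ReachIn.travel₁ y (f (h k)) ?_).trans <|
      (ReachIn.switch (d' := 2) ?_ ?_ ?_).trans <| (ReachIn.travel₂ (e (g k)) x' ?_).trans <|
      (ReachIn.switch (d' := 1) ?_ ?_ ?_).trans <|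
      (ReachIn.step₁ ((hfadj (h k)).imp Eq.symm SimpleGraph.Adj.symm) ?_ ?_))
      subset_rfl (by omega) <;> simp
  · refine ReachIn.mono ((hP.cube₂ ?_).trans <| (ReachIn.switch (d' := 1) ?_ ?_ ?_).trans <|
      (hQ.symm.cube₁ ?_)) subset_rfl (by omega) <;>
      simp +contextual [hP.right_mem, hQ.right_mem]
  · refine ReachIn.mono (
      (ReachIn.switch (d' := 0) ?_ ?_ ?_).trans <| (ReachIn.travel₀ z z₁ ?_).trans <|
      (ReachIn.switch (d' := 1) ?_ ?_ ?_).trans <| (ReachIn.travel₁ y y' ?_).trans <|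
      (ReachIn.switch (d' := 2) ?_ ?_ ?_).trans <| (ReachIn.travel₂ x x' ?_).trans <|
      (ReachIn.switch (d' := 0) ?_ ?_ ?_).trans <| (ReachIn.step₀ (Or.inr hzadj) ?_ ?_).trans <|
      (ReachIn.switch (d' := 1) ?_ ?_ ?_))
      subset_rfl (by omega) <;> simp
  · intro i j hij
    have h1 := he.ne (hg.ne hij)
    have h2 := hf.ne (hh.ne hij)
    have h3 := hfy (h i)
    have h4 := hfy (h j)
    have h5 := hex' (g i)
    have h6 := hex' (g j)
    refine E3CVertex.forall ?_ ?_ ?_ <;>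
      simp only [mem_layered_two, mem_layered_one, mem_layered_zero, Prod.mk.injEq] <;> grind
  · intro i
    have h1 := heP (g i)
    have h2 := hfQ (h i)
    have h3 := hfy (h i)
    have h5 := hex' (g i)
    refine E3CVertex.forall ?_ ?_ ?_ <;>
      simp only [mem_layered_two, mem_layered_one, mem_layered_zero, Prod.mk.injEq] <;> grind
  · intro i
    refine E3CVertex.forall ?_ ?_ ?_ <;>
      simp only [mem_layered_two, mem_layered_one, mem_layered_zero, Prod.mk.injEq] <;> grind
  · refine E3CVertex.forall ?_ ?_ ?_ <;>
      simp only [mem_layered_two, mem_layered_one, mem_layered_zero, Prod.mk.injEq] <;> grind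

/-- Besides the `2 * m` tagged paths there are the edge itself and the path over the third vertex of
the triangle in `d`. -/
theorem wideDist_two_one_of_adj (hm : 1 ≤ m) (hr : m ≤ r) (hs : m ≤ s)
    (x : Fin r → Fin 3) (y : Fin s → Fin 3) (z : Fin t → Fin 3) :
    wideDist (E3C r s t) (2 * m + 2) (x, y, z, 2) (x, y, z, 1) ≤ (r + s + t + 6 : ℕ) := by
  obtain ⟨-, e, -, he, hadj, -⟩ := exists_ternaryCube_fan (hm.trans hr) x x
  obtain ⟨-, f, -, hf, hfadj, -⟩ := exists_ternaryCube_fan (hm.trans hs) y y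
  let g : Fin (2 * m) → Fin (2 * r) := Fin.castLE (by omega)
  let h : Fin (2 * m) → Fin (2 * s) := Fin.castLE (by omega)
  have hg : Function.Injective g := Fin.castLE_injective _
  have hh : Function.Injective h := Fin.castLE_injective _
  have hex : ∀ k, e k ≠ x := fun k => (hadj k).ne'
  have hfy : ∀ k, f k ≠ y := fun k => (hfadj k).ne'
  refine wideDist_le_of_fst (ι := Option (Option (Fin (2 * m)))) (L := r + s + t + 5) (by simp)
    (fun o => o.elim (x, y, z, 0) fun o => o.elim (x, y, z, 1) fun k => (e (g k), y, z, 2))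
    (fun o => o.elim {(x, y, z, 0), (x, y, z, 1)} fun o => o.elim {(x, y, z, 1)} fun k => layered
      (fun a b c => (b = y ∧ c = z ∧ a = e (g k)) ∨ (b = f (h k) ∧ c = z))
      (fun a b c => (a = e (g k) ∧ c = z) ∨ (a = x ∧ c = z ∧ (b = f (h k) ∨ b = y)))
      (fun _ _ _ => False)) ?_ ?_ ?_ ?_ ?_
  · rintro (_ | _ | k)
    · exact Or.inl ⟨rfl, rfl, rfl, by simp⟩
    · exact Or.inl ⟨rfl, rfl, rfl, by simp⟩
    · exact Or.inr (Or.inr (Or.inr ⟨hadj (g k), rfl, rfl, rfl, rfl⟩))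
  · rintro (_ | _ | k)
    · exact (ReachIn.switch (by simp) (by simp) (by simp)).mono subset_rfl (by omega)
    · exact .refl (by simp) _
    · refine ReachIn.mono (
        (ReachIn.switch (d' := 1) ?_ ?_ ?_).trans <| (ReachIn.travel₁ y (f (h k)) ?_).trans <|
        (ReachIn.switch (d' := 2) ?_ ?_ ?_).trans <| (ReachIn.travel₂ (e (g k)) x ?_).trans <|
        (ReachIn.switch (d' := 1) ?_ ?_ ?_).trans <|
        (ReachIn.step₁ (Or.inr (hfadj (h k)).symm) ?_ ?_))
        subset_rfl (by omega) <;> simp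
  · rintro (_ | _ | k)
    · simp
    · simp
    · have h1 := hex (g k)
      have h2 := hfy (h k)
      simp [h1.symm, h2.symm]
  · refine forall_ne_option (D := fun S T => ∀ p ∈ S, p ∈ T → p = (x, y, z, 1))
      (fun s t h p hp hq => h p hq hp) (forall_ne_option
        (D := fun S T => ∀ p ∈ S, p ∈ T → p = (x, y, z, 1))
      (fun s t h p hp hq => h p hq hp) ?_ ?_) ?_
    · intro i j hij
      have h1 := he.ne (hg.ne hij)
      have h2 := hf.ne (hh.ne hij)
      have h3 := hfy (h i)
      have h4 := hfy (h j)
      have h5 := hex (g i)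
      have h6 := hex (g j)
      refine E3CVertex.forall ?_ ?_ ?_ <;>
        simp only [mem_layered_two, mem_layered_one, mem_layered_zero, Prod.mk.injEq] <;> grind
    · exact fun i p _ hp => hp
    · rintro (_ | k)
      · exact fun p hp _ => hp
      · rintro p hp (rfl | hp')
        · simp at hp
        · exact hp'
  · rintro (_ | _ | k) (_ | _ | l) <;> simp

/-- All paths but one visit layer 1 before layer 0, told apart by the value of `A` there, namely `e
k` or `x'`. The last visits layer 0 first: it meets layer 0 at `B = y` instead of `y'` and layer 1
at `C = z'` instead of `z`. -/
theorem wideDist_two_two_of_ne_of_ne (hm : 1 ≤ m) (hr : m ≤ r)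
    (x x' : Fin r → Fin 3) {y y' : Fin s → Fin 3} {z z' : Fin t → Fin 3} (hy : y ≠ y')
    (hz : z ≠ z') :
    wideDist (E3C r s t) (2 * m + 2) (x, y, z, 2) (x', y', z', 2) ≤ (r + s + t + 6 : ℕ) := by
  obtain ⟨e, P, Q, he, hadj, hex', hP, hPP, hQ, heQ⟩ :=
    exists_ternaryCube_closedFan (hm.trans hr) x x'
  refine wideDist_le_of_option_option (J := Fin (2 * r)) (by simpa using hr) (by simp [hy])
    (by rw [E3C_adj]; simp [hy, hz])
    (fun k => layered
      (fun a b c => (b = y ∧ c = z ∧ (a = x ∨ a = e k)) ∨ (a ∈ P k ∧ b = y' ∧ c = z'))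
      (fun a b c => a = e k ∧ c = z)
      (fun a b c => a = e k ∧ b = y'))
    (layered
      (fun a b c => (a ∈ Q ∧ b = y ∧ c = z) ∨ (a = x' ∧ b = y' ∧ c = z'))
      (fun a b c => a = x' ∧ c = z)
      (fun a b c => a = x' ∧ b = y'))
    (layered
      (fun a b c => (b = y ∧ c = z') ∨ (a = x ∧ b = y ∧ c = z) ∨ (a = x' ∧ b = y' ∧ c = z'))
      (fun a b c => a = x' ∧ c = z')
      (fun a b c => a = x ∧ b = y))
    (fun k => ?_) ?_ ?_ ?_ ?_ ?_ ?_
  · refine ReachIn.mono ((ReachIn.step₂ (hadj k) ?_ ?_).trans <|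
      (ReachIn.switch (d' := 1) ?_ ?_ ?_).trans <| (ReachIn.travel₁ y y' ?_).trans <|
      (ReachIn.switch (d' := 0) ?_ ?_ ?_).trans <| (ReachIn.travel₀ z z' ?_).trans <|
      (ReachIn.switch (d' := 2) ?_ ?_ ?_).trans <| ((hP k).cube₂ ?_))
      subset_rfl (by omega) <;> simp +contextual [(hP k).left_mem]
  · refine ReachIn.mono ((hQ.cube₂ ?_).trans <| (ReachIn.switch (d' := 1) ?_ ?_ ?_).trans <|
      (ReachIn.travel₁ y y' ?_).trans <| (ReachIn.switch (d' := 0) ?_ ?_ ?_).trans <|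
      (ReachIn.travel₀ z z' ?_).trans <| (ReachIn.switch (d' := 2) ?_ ?_ ?_))
      subset_rfl (by omega) <;> simp +contextual [hQ.right_mem]
  · refine ReachIn.mono ((ReachIn.switch (d' := 0) ?_ ?_ ?_).trans <|
      (ReachIn.travel₀ z z' ?_).trans <| (ReachIn.switch (d' := 2) ?_ ?_ ?_).trans <|
      (ReachIn.travel₂ x x' ?_).trans <| (ReachIn.switch (d' := 1) ?_ ?_ ?_).trans <|
      (ReachIn.travel₁ y y' ?_).trans <| (ReachIn.switch (d' := 2) ?_ ?_ ?_))
      subset_rfl (by omega) <;> simp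
  · intro i j hij
    have h1 := he.ne hij
    have h2 := hPP i j hij
    refine E3CVertex.forall ?_ ?_ ?_ <;>
      simp only [mem_layered_two, mem_layered_one, mem_layered_zero, Prod.mk.injEq] <;> grind
  · intro i
    have h1 := heQ i
    have h2 := hex' i
    refine E3CVertex.forall ?_ ?_ ?_ <;>
      simp only [mem_layered_two, mem_layered_one, mem_layered_zero, Prod.mk.injEq] <;> grind
  · intro i
    refine E3CVertex.forall ?_ ?_ ?_ <;>
      simp only [mem_layered_two, mem_layered_one, mem_layered_zero, Prod.mk.injEq] <;> grind
  · refine E3CVertex.forall ?_ ?_ ?_ <;>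
      simp only [mem_layered_two, mem_layered_one, mem_layered_zero, Prod.mk.injEq] <;> grind

/-- Reversing the order of layers no longer separates the last path, since `C` need not change; it
makes its `B` and `A` changes at a neighbour `z₁` of `z`. -/
theorem wideDist_two_two_of_ne_of_eq (hm : 1 ≤ m) (hr : m ≤ r) (ht : m ≤ t)
    (x x' : Fin r → Fin 3) {y y' : Fin s → Fin 3} (z : Fin t → Fin 3) (hy : y ≠ y') :
    wideDist (E3C r s t) (2 * m + 2) (x, y, z, 2) (x', y', z, 2) ≤ (r + s + t + 6 : ℕ) := by
  obtain ⟨e, P, Q, he, hadj, hex', hP, hPP, hQ, heQ⟩ :=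
    exists_ternaryCube_closedFan (hm.trans hr) x x'
  obtain ⟨z₁, -, hz1, hzadj⟩ := exists_third_vertex (hm.trans ht) z z
  refine wideDist_le_of_option_option (J := Fin (2 * r)) (by simpa using hr) (by simp [hy])
    (by rw [E3C_adj]; simp [hy])
    (fun k => layered
      (fun a b c => (b = y ∧ c = z ∧ (a = x ∨ a = e k)) ∨ (a ∈ P k ∧ b = y' ∧ c = z))
      (fun a b c => a = e k ∧ c = z)
      (fun _ _ _ => False))
    (layered
      (fun a b c => (a ∈ Q ∧ b = y ∧ c = z) ∨ (a = x' ∧ b = y' ∧ c = z))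
      (fun a b c => a = x' ∧ c = z)
      (fun _ _ _ => False))
    (layered
      (fun a b c => (b = y' ∧ c = z₁) ∨ (a = x ∧ b = y ∧ c = z) ∨ (a = x' ∧ b = y' ∧ c = z))
      (fun a b c => a = x ∧ c = z₁)
      (fun a b c => (a = x ∧ b = y) ∨ (a = x' ∧ b = y')))
    (fun k => ?_) ?_ ?_ ?_ ?_ ?_ ?_
  · refine ReachIn.mono ((ReachIn.step₂ (hadj k) ?_ ?_).trans <|
      (ReachIn.switch (d' := 1) ?_ ?_ ?_).trans <| (ReachIn.travel₁ y y' ?_).trans <|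
      (ReachIn.switch (d' := 2) ?_ ?_ ?_).trans <| ((hP k).cube₂ ?_))
      subset_rfl (by omega) <;> simp +contextual [(hP k).left_mem]
  · refine ReachIn.mono ((hQ.cube₂ ?_).trans <| (ReachIn.switch (d' := 1) ?_ ?_ ?_).trans <|
      (ReachIn.travel₁ y y' ?_).trans <| (ReachIn.switch (d' := 2) ?_ ?_ ?_))
      subset_rfl (by omega) <;> simp +contextual [hQ.right_mem]
  · refine ReachIn.mono ((ReachIn.switch (d' := 0) ?_ ?_ ?_).trans <|
      (ReachIn.travel₀ z z₁ ?_).trans <| (ReachIn.switch (d' := 1) ?_ ?_ ?_).trans <|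
      (ReachIn.travel₁ y y' ?_).trans <| (ReachIn.switch (d' := 2) ?_ ?_ ?_).trans <|
      (ReachIn.travel₂ x x' ?_).trans <| (ReachIn.switch (d' := 0) ?_ ?_ ?_).trans <|
      (ReachIn.step₀ (Or.inr hzadj) ?_ ?_).trans <| (ReachIn.switch (d' := 2) ?_ ?_ ?_))
      subset_rfl (by omega) <;> simp
  · intro i j hij
    have h1 := he.ne hij
    have h2 := hPP i j hij
    refine E3CVertex.forall ?_ ?_ ?_ <;>
      simp only [mem_layered_two, mem_layered_one, mem_layered_zero, Prod.mk.injEq] <;> grind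
  · intro i
    have h1 := heQ i
    have h2 := hex' i
    refine E3CVertex.forall ?_ ?_ ?_ <;>
      simp only [mem_layered_two, mem_layered_one, mem_layered_zero, Prod.mk.injEq] <;> grind
  · intro i
    refine E3CVertex.forall ?_ ?_ ?_ <;>
      simp only [mem_layered_two, mem_layered_one, mem_layered_zero, Prod.mk.injEq] <;> grind
  · refine E3CVertex.forall ?_ ?_ ?_ <;>
      simp only [mem_layered_two, mem_layered_one, mem_layered_zero, Prod.mk.injEq] <;> grind

/-- The cube of layer 2 contains `2 * r` of the paths; the other two change `A` in the parallel
cubes at `C = z₁` and at `B = y₁`. The ends may be adjacent, hence `wideDist_le_of_fst`. -/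
theorem wideDist_two_two_of_eq (hm : 1 ≤ m) (hr : m ≤ r) (hs : m ≤ s) (ht : m ≤ t)
    {x x' : Fin r → Fin 3} (y : Fin s → Fin 3) (z : Fin t → Fin 3) (hx : x ≠ x') :
    wideDist (E3C r s t) (2 * m + 2) (x, y, z, 2) (x', y, z, 2) ≤ (r + s + t + 6 : ℕ) := by
  obtain ⟨-, e, P, he, hadj, hP, hPP, hxP, -⟩ := exists_ternaryCube_fan (hm.trans hr) x x'
  obtain ⟨y₁, -, hy1, hyadj⟩ := exists_third_vertex (hm.trans hs) y y
  obtain ⟨z₁, -, hz1, hzadj⟩ := exists_third_vertex (hm.trans ht) z z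
  have hxP' : ∀ k, x ∉ P k := fun k hk => hx (hxP k hk)
  refine wideDist_le_of_fst (ι := Option (Option (Fin (2 * r)))) (L := r + s + t + 5)
    (by simpa using hr)
    (fun o => o.elim (x, y, z, 0) fun o => o.elim (x, y, z, 1) fun k => (e k, y, z, 2))
    (fun o => o.elim (layered
        (fun a b c => (b = y ∧ c = z₁) ∨ (a = x' ∧ b = y ∧ c = z))
        (fun _ _ _ => False)
        (fun a b c => (a = x ∧ b = y) ∨ (a = x' ∧ b = y))) fun o => o.elim (layered
        (fun a b c => (b = y₁ ∧ c = z) ∨ (a = x' ∧ b = y ∧ c = z))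
        (fun a b c => (a = x ∧ c = z) ∨ (a = x' ∧ c = z))
        (fun _ _ _ => False)) fun k => layered
      (fun a b c => a ∈ P k ∧ b = y ∧ c = z)
      (fun _ _ _ => False)
      (fun _ _ _ => False)) ?_ ?_ ?_ ?_ ?_
  · rintro (_ | _ | k)
    · exact Or.inl ⟨rfl, rfl, rfl, by simp⟩
    · exact Or.inl ⟨rfl, rfl, rfl, by simp⟩
    · exact Or.inr (Or.inr (Or.inr ⟨hadj k, rfl, rfl, rfl, rfl⟩))
  · rintro (_ | _ | k)
    · refine ReachIn.mono ((ReachIn.step₀ (Or.inr hzadj.symm) ?_ ?_).trans <|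
        (ReachIn.switch (d' := 2) ?_ ?_ ?_).trans <| (ReachIn.travel₂ x x' ?_).trans <|
        (ReachIn.switch (d' := 0) ?_ ?_ ?_).trans <| (ReachIn.step₀ (Or.inr hzadj) ?_ ?_).trans <|
        (ReachIn.switch (d' := 2) ?_ ?_ ?_)) subset_rfl (by omega) <;> simp
    · refine ReachIn.mono ((ReachIn.step₁ (Or.inr hyadj.symm) ?_ ?_).trans <|
        (ReachIn.switch (d' := 2) ?_ ?_ ?_).trans <| (ReachIn.travel₂ x x' ?_).trans <|
        (ReachIn.switch (d' := 1) ?_ ?_ ?_).trans <| (ReachIn.step₁ (Or.inr hyadj) ?_ ?_).trans <|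
        (ReachIn.switch (d' := 2) ?_ ?_ ?_)) subset_rfl (by omega) <;> simp
    · exact ((hP k).cube₂ (by simp)).mono subset_rfl (by omega)
  · rintro (_ | _ | k)
    · simp [hx, hz1.symm]
    · simp [hx, hy1.symm]
    · simp [hxP']
  · refine forall_ne_option (D := fun S T => ∀ p ∈ S, p ∈ T → p = (x', y, z, 2))
      (fun s t h p hp hq => h p hq hp) (forall_ne_option
        (D := fun S T => ∀ p ∈ S, p ∈ T → p = (x', y, z, 2))
      (fun s t h p hp hq => h p hq hp) ?_ ?_) ?_
    · intro i j hij
      have h2 := hPP i j hij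
      refine E3CVertex.forall ?_ ?_ ?_ <;>
        simp only [mem_layered_two, mem_layered_one, mem_layered_zero, Prod.mk.injEq] <;> grind
    · intro i
      refine E3CVertex.forall ?_ ?_ ?_ <;>
        simp only [mem_layered_two, mem_layered_one, mem_layered_zero, Prod.mk.injEq] <;> grind
    · rintro (_ | k)
      all_goals
        refine E3CVertex.forall ?_ ?_ ?_ <;> simp only [Option.elim,
          mem_layered_two, mem_layered_one, mem_layered_zero, Prod.mk.injEq] <;> grind
  · rintro (_ | _ | k) (_ | _ | l) <;> simp
    intro h h'
    exact he (h.trans h'.symm)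

end EqualBlocks

/-! ### Symmetry between the blocks, and the upper bound. -/

section UpperBound

variable {r s t m : ℕ}

/-- Exchanging the first two blocks. -/
def E3C.swapAB (r s t : ℕ) : E3C r s t ≃g E3C s r t where
  toFun p := (p.2.1, p.1, p.2.2.1, Equiv.swap 1 2 p.2.2.2)
  invFun p := (p.2.1, p.1, p.2.2.1, Equiv.swap 1 2 p.2.2.2)
  left_inv p := by simp
  right_inv p := by simp
  map_rel_iff' := by
    rintro ⟨x, y, z, d⟩ ⟨x', y', z', d'⟩
    simp only [Equiv.coe_fn_mk, E3C_adj]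
    have h0 : ∀ d : Fin 3, Equiv.swap 1 2 d = 0 ↔ d = 0 := by decide
    have h1 : ∀ d : Fin 3, Equiv.swap 1 2 d = 1 ↔ d = 2 := by decide
    have h2 : ∀ d : Fin 3, Equiv.swap 1 2 d = 2 ↔ d = 1 := by decide
    simp only [h0, h1, h2, ne_eq, EmbeddingLike.apply_eq_iff_eq]
    tauto

/-- Exchanging the last two blocks. -/
def E3C.swapBC (r s t : ℕ) : E3C r s t ≃g E3C r t s where
  toFun p := (p.1, p.2.2.1, p.2.1, Equiv.swap 0 1 p.2.2.2)
  invFun p := (p.1, p.2.2.1, p.2.1, Equiv.swap 0 1 p.2.2.2)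
  left_inv p := by simp
  right_inv p := by simp
  map_rel_iff' := by
    rintro ⟨x, y, z, d⟩ ⟨x', y', z', d'⟩
    simp only [Equiv.coe_fn_mk, E3C_adj]
    have h0 : ∀ d : Fin 3, Equiv.swap 0 1 d = 0 ↔ d = 1 := by decide
    have h1 : ∀ d : Fin 3, Equiv.swap 0 1 d = 1 ↔ d = 0 := by decide
    have h2 : ∀ d : Fin 3, Equiv.swap 0 1 d = 2 ↔ d = 2 := by decide
    simp only [h0, h1, h2, ne_eq, EmbeddingLike.apply_eq_iff_eq]
    tauto

theorem wideDist_swapAB {β L : ℕ} {x x' : Fin r → Fin 3} {y y' : Fin s → Fin 3}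
    {z z' : Fin t → Fin 3} {d d' e e' : Fin 3} (he : Equiv.swap 1 2 d = e)
    (he' : Equiv.swap 1 2 d' = e')
    (h : wideDist (E3C s r t) β (y, x, z, e) (y', x', z', e') ≤ (s + r + t + L : ℕ)) :
    wideDist (E3C r s t) β (x, y, z, d) (x', y', z', d') ≤ (r + s + t + L : ℕ) := by
  subst he he'
  rw [add_comm r s]
  exact (wideDist_le_of_iso (E3C.swapAB r s t) β _ _).trans h

theorem wideDist_swapBC {β L : ℕ} {x x' : Fin r → Fin 3} {y y' : Fin s → Fin 3}
    {z z' : Fin t → Fin 3} {d d' e e' : Fin 3} (he : Equiv.swap 0 1 d = e)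
    (he' : Equiv.swap 0 1 d' = e')
    (h : wideDist (E3C r t s) β (x, z, y, e) (x', z', y', e') ≤ (r + t + s + L : ℕ)) :
    wideDist (E3C r s t) β (x, y, z, d) (x', y', z', d') ≤ (r + s + t + L : ℕ) := by
  subst he he'
  rw [add_right_comm r s t]
  exact (wideDist_le_of_iso (E3C.swapBC r s t) β _ _).trans h

theorem wideDist_two_one (hm : 1 ≤ m) (hr : m ≤ r) (hs : m ≤ s) (ht : m ≤ t)
    (x x' : Fin r → Fin 3) (y y' : Fin s → Fin 3) (z z' : Fin t → Fin 3) :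
    wideDist (E3C r s t) (2 * m + 2) (x, y, z, 2) (x', y', z', 1) ≤ (r + s + t + 6 : ℕ) := by
  by_cases hz : z = z'
  · subst hz
    by_cases hxy : x = x' → y ≠ y'
    · exact wideDist_two_one_of_eq hm hr hs ht z hxy
    · push Not at hxy
      obtain ⟨rfl, rfl⟩ := hxy
      exact wideDist_two_one_of_adj hm hr hs x y z
  · exact wideDist_two_one_of_ne hm hr hs ht x x' y y' hz

theorem wideDist_two_two (hm : 1 ≤ m) (hr : m ≤ r) (hs : m ≤ s) (ht : m ≤ t)
    (x x' : Fin r → Fin 3) (y y' : Fin s → Fin 3) (z z' : Fin t → Fin 3)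
    (h : ¬ (x = x' ∧ y = y' ∧ z = z')) :
    wideDist (E3C r s t) (2 * m + 2) (x, y, z, 2) (x', y', z', 2) ≤ (r + s + t + 6 : ℕ) := by
  by_cases hy : y = y' <;> by_cases hz : z = z'
  · subst hy hz
    exact wideDist_two_two_of_eq hm hr hs ht y z fun hx => h ⟨hx, rfl, rfl⟩
  · subst hy
    exact wideDist_swapBC (by decide) (by decide)
      (wideDist_two_two_of_ne_of_eq hm hr hs x x' y hz)
  · subst hz
    exact wideDist_two_two_of_ne_of_eq hm hr ht x x' z hy
  · exact wideDist_two_two_of_ne_of_ne hm hr x x' hy hz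

/-- A common lower bound `m` on the block lengths survives block permutations, unlike the order `r ≤
s ≤ t`. -/
theorem wideDiam_E3C_le (hm : 1 ≤ m) (hr : m ≤ r) (hs : m ≤ s) (ht : m ≤ t) :
    wideDiam (E3C r s t) (2 * m + 2) ≤ (r + s + t + 6 : ℕ) := by
  refine iSup_le fun u => iSup_le fun v => iSup_le fun huv => ?_
  obtain ⟨x, y, z, d⟩ := u
  obtain ⟨x', y', z', d'⟩ := v
  have hne : d = d' → ¬ (x = x' ∧ y = y' ∧ z = z') := by
    rintro rfl ⟨rfl, rfl, rfl⟩
    exact huv rfl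
  match d, d', hne with
  | 0, 0, hne =>
    exact wideDist_swapBC (e := 1) (e' := 1) (by decide) (by decide)
      (wideDist_swapAB (by decide) (by decide) (wideDist_two_two hm ht hr hs _ _ _ _ _ _
        (by have := hne rfl; tauto)))
  | 0, 1, _ =>
    exact wideDist_swapAB (e := 0) (e' := 2) (by decide) (by decide)
      (wideDist_swapBC (e := 1) (e' := 2) (by decide) (by decide)
        (wideDist_swapAB (by decide) (by decide) (wideDist_two_one hm ht hs hr _ _ _ _ _ _)))
  | 0, 2, _ =>
    exact wideDist_swapBC (e := 1) (e' := 2) (by decide) (by decide)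
        (wideDist_swapAB (by decide) (by decide) (wideDist_two_one hm ht hr hs _ _ _ _ _ _))
  | 1, 0, _ =>
    exact wideDist_swapAB (e := 2) (e' := 0) (by decide) (by decide)
      (wideDist_swapBC (by decide) (by decide) (wideDist_two_one hm hs ht hr _ _ _ _ _ _))
  | 1, 1, hne =>
    exact wideDist_swapAB (by decide) (by decide) (wideDist_two_two hm hs hr ht _ _ _ _ _ _
      (by have := hne rfl; tauto))
  | 1, 2, _ =>
    exact wideDist_swapAB (by decide) (by decide) (wideDist_two_one hm hs hr ht _ _ _ _ _ _)
  | 2, 0, _ =>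
    exact wideDist_swapBC (by decide) (by decide) (wideDist_two_one hm hr ht hs _ _ _ _ _ _)
  | 2, 1, _ => exact wideDist_two_one hm hr hs ht _ _ _ _ _ _
  | 2, 2, hne => exact wideDist_two_two hm hr hs ht _ _ _ _ _ _ (hne rfl)

end UpperBound

/-! ### The lower bound by a distance potential. -/

section LowerBound

variable {r s t : ℕ}

/-- The least number of steps that lead from `d` to `2` in a triangle, through `1` if `p` holds
and through `0` if `q` holds. -/
def layerPotential (p q : Bool) (d : Fin 3) : ℕ :=
  match p, q, d with
  | false, false, 2 => 0
  | false, false, _ => 1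
  | true, false, 1 => 1
  | true, false, _ => 2
  | false, true, 0 => 1
  | false, true, _ => 2
  | true, true, 2 => 3
  | true, true, _ => 2

/-- A lower bound for the distance from `p` to `(x, y, z, 2)`. -/
def distPotential (x : Fin r → Fin 3) (y : Fin s → Fin 3) (z : Fin t → Fin 3)
    (p : E3CVertex r s t) : ℕ :=
  hammingDist p.1 x + hammingDist p.2.1 y + hammingDist p.2.2.1 z +
    layerPotential (decide (p.2.1 ≠ y)) (decide (p.2.2.1 ≠ z)) p.2.2.2

/-- A change of layer alters only the layer term, by at most 1. A step inside a layer alters one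
Hamming distance by at most 1; it may also flip the flag demanding a visit to that very layer, on
which the layer term does not depend there. -/
theorem distPotential_le_of_adj {x : Fin r → Fin 3} {y : Fin s → Fin 3} {z : Fin t → Fin 3}
    {p q : E3CVertex r s t} (h : (E3C r s t).Adj p q) :
    distPotential x y z p ≤ distPotential x y z q + 1 := by
  obtain ⟨a, b, c, d⟩ := p
  obtain ⟨a', b', c', d'⟩ := q
  unfold distPotential
  rcases h with ⟨rfl, rfl, rfl, -⟩ | ⟨rfl, rfl, h, rfl, rfl⟩ | ⟨rfl, h, rfl, rfl, rfl⟩ |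
    ⟨h, rfl, rfl, rfl, rfl⟩
  · have key : ∀ (p q : Bool) (d d' : Fin 3), layerPotential p q d ≤ layerPotential p q d' + 1 := by
      decide
    have := key (decide (b ≠ y)) (decide (c ≠ z)) d d'
    dsimp only
    omega
  · have key : ∀ p q q' : Bool, layerPotential p q 0 = layerPotential p q' 0 := by decide
    have h1 := hammingDist_triangle c c' z
    have := key (decide (b ≠ y)) (decide (c ≠ z)) (decide (c' ≠ z))
    dsimp only
    omega
  · have key : ∀ p p' q : Bool, layerPotential p q 1 = layerPotential p' q 1 := by decide
    have h1 := hammingDist_triangle b b' y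
    have := key (decide (b ≠ y)) (decide (b' ≠ y)) (decide (c ≠ z))
    dsimp only
    omega
  · have h1 := hammingDist_triangle a a' x
    dsimp only
    omega

theorem distPotential_le_length {x : Fin r → Fin 3} {y : Fin s → Fin 3} {z : Fin t → Fin 3}
    {p q : E3CVertex r s t} (w : (E3C r s t).Walk p q) :
    distPotential x y z p ≤ distPotential x y z q + w.length := by
  induction w with
  | nil => simp
  | cons h _ ih =>
    have := distPotential_le_of_adj (x := x) (y := y) (z := z) h
    rw [SimpleGraph.Walk.length_cons]
    omega

theorem le_edist_induce_of_unique_neighbor {V : Type*} {G : SimpleGraph V} {T : Set V} {u v e : V}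
    (hu : u ∈ T) (hv : v ∈ T) (huv : u ≠ v) (he : ∀ w ∈ T, G.Adj u w → w = e) {L : ℕ}
    (hL : ∀ w : G.Walk e v, L ≤ w.length) :
    ((L + 1 : ℕ) : ℕ∞) ≤ (G.induce T).edist ⟨u, hu⟩ ⟨v, hv⟩ := by
  refine le_iInf fun w => ?_
  cases w with
  | nil => exact absurd rfl huv
  | @cons _ q _ h w =>
    obtain ⟨q, hq⟩ := q
    obtain rfl := he q hq h
    have h1 := hL (w.map (SimpleGraph.Embedding.induce T).toHom)
    have h2 : (w.map (SimpleGraph.Embedding.induce (G := G) T).toHom).length = w.length :=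
      SimpleGraph.Walk.length_map _ _
    rw [SimpleGraph.Walk.length_cons]
    exact_mod_cast Nat.succ_le_succ (h1.trans_eq h2)

theorem hammingDist_add_one {a : ℕ} (x : Fin a → Fin 3) : hammingDist x (x + 1) = a := by
  simp [hammingDist]

theorem le_faultDiam_E3C (hr : 1 ≤ r) (hs : 1 ≤ s) (ht : 1 ≤ t) :
    ((r + s + t + 4 : ℕ) : ℕ∞) ≤ faultDiam (E3C r s t) (2 * r + 1) := by
  let x : Fin r → Fin 3 := 0
  let y : Fin s → Fin 3 := 0
  let z : Fin t → Fin 3 := 0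
  let k₀ : Fin r × Fin 2 := (⟨0, hr⟩, 0)
  let nbr : Option (Option (Fin r × Fin 2)) → E3CVertex r s t := fun o =>
    o.elim (x, y, z, 0) fun o => o.elim (x, y, z, 1) fun k => (ternaryNbr x k, y, z, 2)
  have hnbr : Function.Injective nbr := by
    rintro (_ | _ | k) (_ | _ | l) h <;> simp [nbr] at h ⊢
    exact ternaryNbr_injective x h
  -- All `2 * r + 2` neighbours of `u` except one inside its own cube.
  let F : Finset (E3CVertex r s t) := (Finset.univ.erase (some (some k₀))).map ⟨nbr, hnbr⟩
  have hF : F.card = 2 * r + 1 := by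
    rw [Finset.card_map, Finset.card_erase_of_mem (Finset.mem_univ _), Finset.card_univ]
    simp [mul_comm]
  have hy : y ≠ y + 1 := fun h => by simpa using congrFun h ⟨0, hs⟩
  have hz : z ≠ z + 1 := fun h => by simpa using congrFun h ⟨0, ht⟩
  let u : E3CVertex r s t := (x, y, z, 2)
  -- Adding 1 everywhere makes `v` differ in every entry of the three blocks from the surviving
  -- neighbour, not merely from `u`.
  let v : E3CVertex r s t := (ternaryNbr x k₀ + 1, y + 1, z + 1, 2)
  have huF : u ∉ F := by
    simp only [F, u, Finset.mem_map, Function.Embedding.coeFn_mk, not_exists, not_and]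
    rintro (_ | _ | k) _ <;> simp [nbr, (ternaryCube_adj_ternaryNbr x _).ne']
  have hvF : v ∉ F := by
    simp only [F, v, Finset.mem_map, Function.Embedding.coeFn_mk, not_exists, not_and]
    rintro (_ | _ | k) _ <;> simp [nbr, hy]
  have huv : u ≠ v := by simp [u, v, hy]
  refine le_trans ?_ (le_iSup₂_of_le u v (le_iSup_of_le huv (le_iSup₂_of_le F hF
    (le_iSup₂_of_le huF hvF le_rfl))))
  refine le_edist_induce_of_unique_neighbor (T := {p | p ∉ F}) (e := nbr (some (some k₀)))
    huF hvF huv (fun w hw hadj => ?_) (fun w => ?_)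
  · obtain ⟨o, rfl⟩ : ∃ o, nbr o = w := by
      obtain ⟨a, b, c, d⟩ := w
      rcases hadj with ⟨rfl, rfl, rfl, h⟩ | ⟨_, _, _, h, _⟩ | ⟨_, _, _, h, _⟩ |
        ⟨h, rfl, rfl, -, rfl⟩
      · match d, h with
        | 0, _ => exact ⟨none, rfl⟩
        | 1, _ => exact ⟨some none, rfl⟩
        | 2, h => exact absurd rfl h
      · simp at h
      · simp at h
      · obtain ⟨k, rfl⟩ := exists_ternaryNbr_eq h
        exact ⟨some (some k), rfl⟩
    by_contra hne
    refine hw (Finset.mem_map.2 ⟨o, Finset.mem_erase.2 ⟨fun h => hne (by rw [h]), ?_⟩, rfl⟩)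
    exact Finset.mem_univ _
  · have h := distPotential_le_length (x := ternaryNbr x k₀ + 1) (y := y + 1) (z := z + 1) w
    have h1 : distPotential (ternaryNbr x k₀ + 1) (y + 1) (z + 1) v = 0 := by
      simp [distPotential, v, layerPotential]
    -- The 3 counts the layer changes of a closed tour from layer 2 through both other layers.
    have h2 : distPotential (ternaryNbr x k₀ + 1) (y + 1) (z + 1) (nbr (some (some k₀))) =
        r + s + t + 3 := by
      simp [distPotential, nbr, hammingDist_add_one, hy, hz, layerPotential]
    omega

end LowerBound

theorem theorem3 (r s t n : ℕ) (hr : 1 ≤ r) (hrs : r ≤ s) (hst : s ≤ t)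
    (hn : n = r + s + t + 1) :
    (n : ℕ∞) + 3 ≤ faultDiam (E3C r s t) (2 * r + 1) ∧
      faultDiam (E3C r s t) (2 * r + 1) ≤ wideDiam (E3C r s t) (2 * r + 2) ∧
      wideDiam (E3C r s t) (2 * r + 2) ≤ (n : ℕ∞) + 5 := by
  subst hn
  refine ⟨?_, faultDiam_le_wideDiam _ _, ?_⟩
  · refine le_trans (le_of_eq ?_) (le_faultDiam_E3C hr (hr.trans hrs) (hr.trans (hrs.trans hst)))
    push_cast
    ring
  · refine (wideDiam_E3C_le hr le_rfl hrs (hrs.trans hst)).trans (le_of_eq ?_)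
    push_cast
    ring
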